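/- Fix an integer $f \ge 0$. A $k$-fault-tolerant exact distance labeling scheme (without edge labels) assigns to every vertex $v$ of every finite simple undirected unweighted graph $G$, with vertex set $\{0,\dots,n-1\}$, a bitstring $L_G(v)$, and comes with a single decoding function $D$, independent of $G$ and $n$, such that for all such $G$, all vertices $s,t$ of $G$, and all sets $F \subseteq E(G)$ with $|F| \le k$, $$D\bigl(L_G(s), L_G(t), F\bigr) = \mathrm{dist}_{G \setminus F}(s,t),$$ where $F$ is given to $D$ as a set of unordered pairs of vertex names, and $\mathrm{dist}_{G\setminus F}(s,t) = \infty$ if $s$ and $t$ are disconnected in $G \setminus F$. Then there is an $(f+1)$-fault-tolerant exact distance labeling scheme whose labels have size $\widetilde{O}(n^{2-1/2^f})$; that is, there are constants $C$ and $c$ (which may depend on $f$) such that for every $n$-vertex graph $G$ and every vertex $v$ of $G$, the label $L_G(v)$ has at most $C \, n^{2-1/2^f} \, (\log (n+2))^{c}$ bits. -/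

import Mathlib

/-- The description of a set of edges that a decoder is shown: the unordered pairs of the names of
their endpoints. The vertices of an `n`-vertex graph are named `0, …, n - 1`. -/
def edgeSetDescription {n : ℕ} (F : Finset (Sym2 (Fin n))) : Finset (Sym2 ℕ) :=
  F.image (Sym2.map Fin.val)

/-- A `k`-fault-tolerant exact distance labeling scheme (without edge labels) for unweighted
undirected graphs: a rule assigning a bitstring to every vertex of every finite graph, with
one decoder (which sees neither the graph nor its number of vertices) that
recovers the distance of `s` and `t` in `G ∖ F` from the labels of `s` and `t` and the description
of `F`, for every set `F` of at most `k` edges of `G`. The distance is `⊤` if `s` and `t` are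
disconnected in `G ∖ F`. -/
structure FTDistanceLabelingScheme (k : ℕ) where
  /-- The label of each vertex of each graph. -/
  label : {n : ℕ} → SimpleGraph (Fin n) → Fin n → List Bool
  /-- The decoder. -/
  decode : List Bool → List Bool → Finset (Sym2 ℕ) → ℕ∞
  /-- The decoder is always right. -/
  decode_eq : ∀ {n : ℕ} (G : SimpleGraph (Fin n)) (s t : Fin n) (F : Finset (Sym2 (Fin n))),
    (F : Set (Sym2 (Fin n))) ⊆ G.edgeSet → F.card ≤ k →
      decode (label G s) (label G t) (edgeSetDescription F) =
        (G.deleteEdges (F : Set (Sym2 (Fin n)))).edist s t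

/-- All labels given to the vertices of `n`-vertex graphs have bit length `Õ(b n)`, that is, at most
a constant times `b n` times a fixed power of `log n`. The logarithm is shifted (`log (n + 2)`) only
to keep it positive for all `n`. -/
def FTDistanceLabelingScheme.HasLabelSizeSoftO {k : ℕ} (S : FTDistanceLabelingScheme k)
    (b : ℕ → ℝ) : Prop :=
  ∃ (C : ℝ) (c : ℕ), ∀ (n : ℕ) (G : SimpleGraph (Fin n)) (v : Fin n),
    ((S.label G v).length : ℝ) ≤ C * b n * Real.log ((n : ℝ) + 2) ^ c

/-!
The label of `s` lists the arcs of a sparse subgraph `H s` of `G`, and the decoder computes the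
distance of `s` and `t` in `(H s ∪ H t) ∖ F`. Two facts make this work.

*Restorable tie-breaking.* Walks are weighed by their length first, and then by a tie-breaking part
that changes sign when an edge is traversed backwards (`arcWeight`). The tie-breaking is fine enough
that for every set `F` of edges the walk of least weight between two vertices that avoids `F` is
unique (`IsBest.unique`), so parts of best walks are best, and a best walk stays the same as long as
the faults added or removed do not matter to it. Let `H s` be the union of the best walks from `s`
that avoid at most `f` faults. By antisymmetry (`exists_isBest_append_of_shortest`), if one more edge
`e` fails besides `F`, then some shortest `s`-`t` walk avoiding `F ∪ {e}` is a best walk from `s` and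
a best walk from `t`, both for `F` alone, joined at a vertex. Hence `H s ∪ H t` preserves the
distance of `s` and `t` under `f + 1` faults (`exists_walk_preserverArcs`).

*Sparsity.* `H s` is the union over all `t` of the last edges of the best walks from `s` to `t`, and
for each `t` there are about `n ^ (1 - 1 / 2 ^ f)` of these (`exists_penultimate_cover`). To see
this, fix length scales `a i ≈ n ^ (1 / 2 ^ i)` for `1 ≤ i ≤ f`. Starting from the best walk with no
faults, repeatedly pick a fault `e ∈ F` on the best walk avoiding the faults found so far, and charge
it to the smallest unused scale `a i` such that `e` is among the last `a i` edges. If this never gets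
stuck, the final walk is one of at most about `∏ i, a i` many, which is `n ^ (1 - 1 / 2 ^ f)`.
Otherwise, let `a j` be the largest unused scale. The fault that does not fit, and the `j - 1` faults
charged to larger scales, are then at distance more than `a j` from `t`, and do not matter to
the last `a j` edges of any walk to `t`. A set of about `n / a j` vertices hits these last stretches
of all best walks (`exists_hitting_set_of_isBest`), and it remains to count the last edges of best
walks from such vertices with only `f - j` faults, by the same argument with the scales after `j`.
Since `a (j + 1) ⋯ a f ≈ a j / a f`, this again gives about `n / a f = n ^ (1 - 1 / 2 ^ f)`.
-/

open SimpleGraph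
open scoped Nat

/-! ### Walks avoiding a set of edges -/

section Avoids

variable {V : Type*} {G : SimpleGraph V} {u v w : V} {F : Finset (Sym2 V)}

/-- The walk uses no edge of `F`. -/
def Avoids (F : Finset (Sym2 V)) (p : G.Walk u v) : Prop := ∀ e ∈ p.edges, e ∉ F

theorem Avoids.mono {F' : Finset (Sym2 V)} {p : G.Walk u v} (hp : Avoids F p) (h : F' ⊆ F) :
    Avoids F' p := fun e he hF => hp e he (h hF)

@[simp] theorem avoids_nil : Avoids F (Walk.nil : G.Walk u u) := by simp [Avoids]

theorem avoids_cons {h : G.Adj u v} {p : G.Walk v w} :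
    Avoids F (Walk.cons h p) ↔ s(u, v) ∉ F ∧ Avoids F p := by
  simp [Avoids]

theorem avoids_append {p : G.Walk u v} {q : G.Walk v w} :
    Avoids F (p.append q) ↔ Avoids F p ∧ Avoids F q := by
  simp only [Avoids, Walk.edges_append, List.mem_append]
  exact ⟨fun h => ⟨fun e he => h e (Or.inl he), fun e he => h e (Or.inr he)⟩,
    fun h e he => he.elim (h.1 e) (h.2 e)⟩

theorem avoids_reverse {p : G.Walk u v} : Avoids F p.reverse ↔ Avoids F p := by
  simp [Avoids]

theorem avoids_insert [DecidableEq V] {e : Sym2 V} {p : G.Walk u v} :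
    Avoids (insert e F) p ↔ e ∉ p.edges ∧ Avoids F p := by
  simp only [Avoids, Finset.mem_insert, not_or]
  exact ⟨fun h => ⟨fun he => (h e he).1 rfl, fun e he => (h e he).2⟩,
    fun h e' he' => ⟨fun h' => h.1 (h' ▸ he'), h.2 e' he'⟩⟩

theorem exists_append_cons_of_mem_edges {p : G.Walk u v} {e : Sym2 V} (he : e ∈ p.edges) :
    ∃ (a b : V) (p₁ : G.Walk u a) (h : G.Adj a b) (p₂ : G.Walk b v),
      e = s(a, b) ∧ p = p₁.append (Walk.cons h p₂) := by
  induction p with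
  | nil => simp at he
  | @cons u x v h p ih =>
    rw [Walk.edges_cons, List.mem_cons] at he
    rcases he with rfl | he
    · exact ⟨u, x, Walk.nil, h, p, rfl, rfl⟩
    · obtain ⟨a, b, p₁, h', p₂, rfl, rfl⟩ := ih he
      exact ⟨a, b, Walk.cons h p₁, h', p₂, rfl, rfl⟩

theorem notMem_edges_of_isPath_append_cons {a b : V} {p₁ : G.Walk u a} {h : G.Adj a b}
    {p₂ : G.Walk b v} (hp : (p₁.append (Walk.cons h p₂)).IsPath) :
    s(a, b) ∉ p₁.edges ∧ s(a, b) ∉ p₂.edges := by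
  have := hp.isTrail.edges_nodup
  rw [Walk.edges_append, Walk.edges_cons, List.nodup_append, List.nodup_cons] at this
  exact ⟨fun h' => this.2.2 _ h' _ List.mem_cons_self rfl, this.2.1.1⟩

end Avoids

/-! ### Antisymmetric tie-breaking weights -/

/-- The ordered group in which walks are weighed: the first component counts edges, and the second,
compared lexicographically, breaks ties. -/
abbrev TieWeight (V : Type*) [LinearOrder V] := ℤ ×ₗ Lex ((V ×ₗ V) →₀ ℤ)

/-- The weight of traversing an edge from `u` to `v`: one unit of length, and a tie-breaking part
that changes sign when the edge is traversed in the other direction. -/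
noncomputable def arcWeight {V : Type*} [LinearOrder V] (u v : V) : TieWeight V :=
  toLex (1, toLex (Finsupp.single (toLex (u, v)) 1 - Finsupp.single (toLex (v, u)) 1))

theorem arcWeight_add_swap {V : Type*} [LinearOrder V] (u v : V) :
    arcWeight u v + arcWeight v u = toLex (2, 0) := by
  unfold arcWeight
  rw [← toLex_add, Prod.mk_add_mk, ← toLex_add]
  norm_num

section Walks

variable {V : Type*} [LinearOrder V] {G : SimpleGraph V} {u v w x : V}

/-- The total weight of the arcs of a walk. -/
noncomputable def walkWeight (p : G.Walk u v) : TieWeight V :=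
  (p.darts.map fun d => arcWeight d.fst d.snd).sum

@[simp] theorem walkWeight_nil : walkWeight (Walk.nil : G.Walk u u) = 0 := by
  simp [walkWeight]

@[simp] theorem walkWeight_cons (h : G.Adj u v) (p : G.Walk v w) :
    walkWeight (Walk.cons h p) = arcWeight u v + walkWeight p := by
  simp [walkWeight]

@[simp] theorem walkWeight_append (p : G.Walk u v) (q : G.Walk v w) :
    walkWeight (p.append q) = walkWeight p + walkWeight q := by
  simp [walkWeight]

theorem walkWeight_fst (p : G.Walk u v) : (ofLex (walkWeight p)).1 = p.length := by
  induction p with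
  | nil => simp
  | cons h p ih =>
    rw [walkWeight_cons, ofLex_add, Prod.fst_add, ih, Walk.length_cons]
    simp only [arcWeight, ofLex_toLex]
    push_cast
    ring

theorem walkWeight_lt_of_length_lt {u' v' : V} {p : G.Walk u v} {q : G.Walk u' v'}
    (h : p.length < q.length) : walkWeight p < walkWeight q := by
  rw [Prod.Lex.lt_iff]
  left
  rw [walkWeight_fst, walkWeight_fst]
  exact_mod_cast h

theorem length_le_of_walkWeight_le {u' v' : V} {p : G.Walk u v} {q : G.Walk u' v'}
    (h : walkWeight p ≤ walkWeight q) : p.length ≤ q.length := by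
  by_contra! hlt
  exact absurd h (walkWeight_lt_of_length_lt hlt).not_ge

/-- The number of times that a walk traverses the edge `ab` from `a` to `b`, minus the number of
times that it traverses it from `b` to `a`. -/
noncomputable def netTraversals (p : G.Walk u v) (a b : V) : ℤ :=
  (ofLex (ofLex (walkWeight p)).2) (toLex (a, b))

theorem netTraversals_cons (h : G.Adj u v) (p : G.Walk v w) (a b : V) :
    netTraversals (Walk.cons h p) a b =
      (if u = a ∧ v = b then 1 else 0) - (if v = a ∧ u = b then 1 else 0) + netTraversals p a b := by
  unfold netTraversals
  rw [walkWeight_cons, ofLex_add, Prod.snd_add, ofLex_add, Finsupp.add_apply]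
  simp [arcWeight, Finsupp.single_apply, Prod.ext_iff]

theorem netTraversals_eq_zero (p : G.Walk u v) (a b : V) (ha : a ∉ p.support) :
    netTraversals p a b = 0 := by
  induction p with
  | nil => simp [netTraversals]
  | @cons u v w h p ih =>
    rw [Walk.support_cons, List.mem_cons, not_or] at ha
    rw [netTraversals_cons, ih ha.2, if_neg, if_neg]
    · simp
    · rintro ⟨rfl, -⟩
      exact ha.2 p.start_mem_support
    · rintro ⟨rfl, -⟩
      exact ha.1 rfl

/-! ### Best walks avoiding a set of edges -/

/-- The walk has the least weight among those between its endpoints that avoid `F`. -/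
def IsBest (F : Finset (Sym2 V)) (p : G.Walk u v) : Prop :=
  Avoids F p ∧ ∀ q : G.Walk u v, Avoids F q → walkWeight p ≤ walkWeight q

variable {F : Finset (Sym2 V)}

theorem IsBest.length_le {p q : G.Walk u v} (hp : IsBest F p) (hq : Avoids F q) :
    p.length ≤ q.length := length_le_of_walkWeight_le (hp.2 q hq)

theorem IsBest.of_append_left {p : G.Walk u v} {q : G.Walk v w} (h : IsBest F (p.append q)) :
    IsBest F p := by
  obtain ⟨ha, hmin⟩ := h
  rw [avoids_append] at ha
  refine ⟨ha.1, fun r hr => ?_⟩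
  have := hmin (r.append q) (avoids_append.2 ⟨hr, ha.2⟩)
  simpa using this

theorem IsBest.of_append_right {p : G.Walk u v} {q : G.Walk v w} (h : IsBest F (p.append q)) :
    IsBest F q := by
  obtain ⟨ha, hmin⟩ := h
  rw [avoids_append] at ha
  refine ⟨ha.2, fun r hr => ?_⟩
  have := hmin (p.append r) (avoids_append.2 ⟨ha.1, hr⟩)
  simpa using this

theorem IsBest.of_cons {h : G.Adj u v} {p : G.Walk v w} (hp : IsBest F (Walk.cons h p)) :
    IsBest F p :=
  IsBest.of_append_right (p := Walk.cons h Walk.nil) (by simpa using hp)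

theorem isBest_nil : IsBest F (Walk.nil : G.Walk u u) := by
  refine ⟨avoids_nil, fun q _ => ?_⟩
  cases q with
  | nil => exact le_rfl
  | cons h q => exact (walkWeight_lt_of_length_lt (by simp)).le

theorem IsBest.isPath {p : G.Walk u v} (hp : IsBest F p) : p.IsPath := by
  have hle := hp.length_le (q := p.bypass) fun e he => hp.1 e (p.edges_bypass_subset_edges he)
  rw [← p.bypass_eq_self_of_length_le_length_bypass hle]
  exact p.bypass_isPath

/-- Two distinct best walks would have equal weight. At the first vertex `u` where they part, one
of them leaves by an edge `ua`; neither comes back to `u`, so the other has a different net number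
of traversals of that edge, which is a coordinate of the weight. -/
theorem IsBest.unique {p q : G.Walk u v} (hp : IsBest F p) (hq : IsBest F q) : p = q := by
  induction p with
  | nil => exact (Walk.eq_nil_iff_nil.2 (Walk.isPath_iff_nil.1 hq.isPath)).symm
  | @cons u a w h p ih =>
    cases q with
    | nil => exact absurd hp.isPath (by simp)
    | @cons _ b _ h' q =>
      have hweight := le_antisymm (hp.2 _ hq.1) (hq.2 _ hp.1)
      have hup := ((Walk.cons_isPath_iff h p).1 hp.isPath).2
      have huq := ((Walk.cons_isPath_iff h' q).1 hq.isPath).2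
      have hab : a = b := by
        by_contra hab
        have hnet : netTraversals (Walk.cons h p) u a = netTraversals (Walk.cons h' q) u a := by
          unfold netTraversals
          rw [hweight]
        rw [netTraversals_cons, netTraversals_cons, netTraversals_eq_zero p u a hup,
          netTraversals_eq_zero q u a huq, if_pos ⟨rfl, rfl⟩, if_neg fun h0 => h.ne h0.1.symm,
          if_neg fun h0 => hab h0.2.symm, if_neg fun h0 => h'.ne h0.1.symm] at hnet
        norm_num at hnet
      subst hab
      rw [ih hp.of_cons hq.of_cons]

theorem exists_isBest [Fintype V] (p : G.Walk u v) (hp : Avoids F p) :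
    ∃ q : G.Walk u v, IsBest F q := by
  classical
  have hex : ∃ m, ∃ q : G.Walk u v, Avoids F q ∧ q.length = m := ⟨_, p, hp, rfl⟩
  obtain ⟨q₀, hq₀, hlen⟩ := Nat.find_spec hex
  let S : Finset (G.Walk u v) := (G.finsetWalkLength (Nat.find hex) u v).filter (Avoids F)
  have hS : S.Nonempty := ⟨q₀, Finset.mem_filter.2 ⟨mem_finsetWalkLength_iff.2 hlen, hq₀⟩⟩
  obtain ⟨q, hq, hmin⟩ := S.exists_min_image walkWeight hS
  obtain ⟨hqlen, hqF⟩ := Finset.mem_filter.1 hq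
  rw [mem_finsetWalkLength_iff] at hqlen
  refine ⟨q, hqF, fun r hr => ?_⟩
  rcases (Nat.find_min' hex ⟨r, hr, rfl⟩).lt_or_eq with hlt | heq
  · exact (walkWeight_lt_of_length_lt (hqlen ▸ hlt)).le
  · exact hmin r (Finset.mem_filter.2 ⟨mem_finsetWalkLength_iff.2 heq.symm, hr⟩)

end Walks

/-! ### Restoration of a shortest walk after one further fault -/

theorem exists_append_cons_of_start_of_not_end {V : Type*} {G : SimpleGraph V} {u v : V}
    {P : V → Prop} (q : G.Walk u v) (hu : P u) (hv : ¬ P v) :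
    ∃ (x y : V) (q₁ : G.Walk u x) (h : G.Adj x y) (q₂ : G.Walk y v),
      q = q₁.append (Walk.cons h q₂) ∧ P x ∧ ¬ P y := by
  induction q with
  | nil => exact absurd hu hv
  | @cons u a v h q ih =>
    by_cases ha : P a
    · obtain ⟨x, y, q₁, h', q₂, rfl, hx, hy⟩ := ih ha hv
      exact ⟨x, y, Walk.cons h q₁, h', q₂, rfl, hx, hy⟩
    · exact ⟨u, a, Walk.nil, h, q, rfl, hu, ha⟩

section Restoration

variable {V : Type*} [LinearOrder V] {G : SimpleGraph V} {F : Finset (Sym2 V)}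

/-- If the best walk from `a` to `y` starts with the arc `ab` and the best walk from `b` to `x`
starts with the arc `ba`, where `x` and `y` are adjacent, then appending `xy` to the rest of the
second walk gives the first one: neither can be strictly better, because the weights of two opposite
arcs have the same sum for the edges `ab` and `xy`. -/
theorem append_cons_eq_of_isBest_of_isBest {a b x y : V} {hab : G.Adj a b} {hba : G.Adj b a}
    {hxy : G.Adj x y} {p : G.Walk b y} {p' : G.Walk a x} (hp : IsBest F (Walk.cons hab p))
    (hp' : IsBest F (Walk.cons hba p')) (hxyF : s(x, y) ∉ F) :
    p'.append (Walk.cons hxy Walk.nil) = Walk.cons hab p := by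
  have hq : Avoids F (p'.append (Walk.cons hxy Walk.nil)) :=
    avoids_append.2 ⟨hp'.of_cons.1, avoids_cons.2 ⟨hxyF, avoids_nil⟩⟩
  have hq' : Avoids F (p.append (Walk.cons hxy.symm Walk.nil)) :=
    avoids_append.2 ⟨hp.of_cons.1, avoids_cons.2 ⟨by rwa [Sym2.eq_swap], avoids_nil⟩⟩
  have h1 := hp.2 _ hq
  have h2 := hp'.2 _ hq'
  simp only [walkWeight_cons, walkWeight_append, walkWeight_nil, add_zero] at h1 h2
  have hsum : arcWeight a b + arcWeight b a = arcWeight x y + arcWeight y x := by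
    rw [arcWeight_add_swap, arcWeight_add_swap]
  have h3 : walkWeight p' + arcWeight x y ≤ arcWeight a b + walkWeight p := by
    have h4 : (arcWeight b a + walkWeight p') + (arcWeight a b + walkWeight p) ≤
        (walkWeight p + arcWeight y x) + (arcWeight a b + walkWeight p) := by gcongr
    have h5 : arcWeight y x = arcWeight a b + arcWeight b a - arcWeight x y := by
      rw [hsum]; abel
    rw [h5] at h4
    have h6 : (arcWeight b a + walkWeight p') + (arcWeight a b + walkWeight p) +
          (arcWeight x y - arcWeight a b - arcWeight b a - walkWeight p) ≤
        (walkWeight p + (arcWeight a b + arcWeight b a - arcWeight x y)) +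
          (arcWeight a b + walkWeight p) +
          (arcWeight x y - arcWeight a b - arcWeight b a - walkWeight p) := by gcongr
    convert h6 using 1 <;> abel
  refine IsBest.unique (F := F) ⟨hq, fun r hr => ?_⟩ hp
  refine le_trans ?_ (hp.2 r hr)
  simpa using h3

/-- The restoration lemma: the `s`-`t` distance after the failure of `F` and one further edge
`e` is attained by joining, at some vertex `x`, two walks that are best when only `F` fails, and
happen to avoid `e`. The vertex `x` is the last one on a shortest walk before the best walks from
`s` begin to use `e`. -/
theorem exists_isBest_append_of_shortest [Fintype V] {s t : V} {e : Sym2 V} (q : G.Walk s t)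
    (hq : Avoids (insert e F) q)
    (hmin : ∀ r : G.Walk s t, Avoids (insert e F) r → q.length ≤ r.length) :
    ∃ (x : V) (p : G.Walk s x) (p' : G.Walk t x), IsBest F p ∧ IsBest F p' ∧
      e ∉ p.edges ∧ e ∉ p'.edges ∧ p.length + p'.length ≤ q.length := by
  by_cases ht : ∃ p : G.Walk s t, IsBest F p ∧ e ∉ p.edges
  · obtain ⟨p, hp, hep⟩ := ht
    exact ⟨t, p, Walk.nil, hp, isBest_nil, hep, by simp,
      by simpa using hp.length_le (avoids_insert.1 hq).2⟩
  obtain ⟨x, y, q₁, hxy, q₂, rfl, ⟨px, hpx, hepx⟩, hy⟩ :=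
    exists_append_cons_of_start_of_not_end (P := fun x => ∃ p : G.Walk s x, IsBest F p ∧ e ∉ p.edges)
      q ⟨Walk.nil, isBest_nil, by simp⟩ ht
  rw [avoids_append, avoids_cons] at hq
  obtain ⟨hq₁, hxyF, hq₂⟩ := hq
  rw [avoids_insert] at hq₁ hq₂
  rw [Finset.mem_insert, not_or] at hxyF
  have hy' : Avoids F (q₁.append (Walk.cons hxy Walk.nil)) :=
    avoids_append.2 ⟨hq₁.2, avoids_cons.2 ⟨hxyF.2, avoids_nil⟩⟩
  have hx' : Avoids F (q₂.reverse.append (Walk.cons hxy.symm Walk.nil)) :=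
    avoids_append.2 ⟨avoids_reverse.2 hq₂.2, avoids_cons.2 ⟨by rw [Sym2.eq_swap]; exact hxyF.2,
      avoids_nil⟩⟩
  obtain ⟨py, hpy⟩ := exists_isBest _ hy'
  obtain ⟨p', hp'⟩ := exists_isBest _ hx'
  have hlen := hpx.length_le hq₁.2
  have hleny := hpy.length_le hy'
  have hlen' := hp'.length_le hx'
  simp only [Walk.length_append, Walk.length_cons, Walk.length_nil, Walk.length_reverse]
    at hleny hlen' hmin ⊢
  have hey : e ∈ py.edges := by
    by_contra h
    exact hy ⟨py, hpy, h⟩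
  refine ⟨x, px, p', hpx, hp', hepx, fun hep' => ?_, by omega⟩
  obtain ⟨a, b, p₁, hab, p₂, rfl, rfl⟩ := exists_append_cons_of_mem_edges hey
  obtain ⟨a', b', p₁', hab', p₂', heq, rfl⟩ := exists_append_cons_of_mem_edges hep'
  have hnot := notMem_edges_of_isPath_append_cons hpy.isPath
  have hnot' := notMem_edges_of_isPath_append_cons hp'.isPath
  have hp₁ := hpy.1
  have hp₁' := hp'.1
  rw [avoids_append] at hp₁ hp₁'
  rw [← heq] at hnot'
  rcases Sym2.eq_iff.1 heq with ⟨rfl, rfl⟩ | ⟨rfl, rfl⟩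
  · -- Both walks traverse `e` in the same direction: their parts before `e` join to a shorter walk.
    have h := hmin (p₁.append p₁'.reverse) (avoids_append.2
      ⟨avoids_insert.2 ⟨hnot.1, hp₁.1⟩, avoids_reverse.2 (avoids_insert.2 ⟨hnot'.1, hp₁'.1⟩)⟩)
    simp only [Walk.length_append, Walk.length_cons, Walk.length_reverse] at h hleny hlen'
    omega
  · -- They traverse `e` in opposite directions, which antisymmetry excludes.
    have h := append_cons_eq_of_isBest_of_isBest (hxy := hxy) hpy.of_append_right
      hp'.of_append_right hxyF.2
    have hmem : s(a, b) ∈ (p₂'.append (Walk.cons hxy Walk.nil)).edges := by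
      rw [h]; simp
    rw [Walk.edges_append, List.mem_append] at hmem
    rcases hmem with hmem | hmem
    · exact hnot'.2 hmem
    · exact hxyF.1 (List.mem_singleton.1 hmem).symm

end Restoration

/-! ### Covering the last edges of the best walks to a vertex -/

section LastEdges

variable {V : Type*} {G : SimpleGraph V} {u v w t : V}

theorem penultimate_append_of_not_nil (p : G.Walk u v) {q : G.Walk v w} (hq : ¬ q.Nil) :
    (p.append q).penultimate = q.penultimate := by
  induction p with
  | nil => rfl
  | cons h p ih =>
    rw [Walk.cons_append, Walk.penultimate_cons_of_not_nil _ _ fun h' => hq ?_, ih hq]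
    rw [Walk.nil_append_iff] at h'
    exact h'.2

end LastEdges

section Cover

variable {V : Type*} [LinearOrder V] {G : SimpleGraph V} {w x t : V} {F A : Finset (Sym2 V)}

theorem IsBest.of_avoids_superset {p : G.Walk w t} (hp : IsBest A p) (hAF : A ⊆ F)
    (hpF : Avoids F p) : IsBest F p :=
  ⟨hpF, fun q hq => hp.2 q (hq.mono hAF)⟩

/-- A walk of length at most `a` to `t` that avoids `A` cannot use an edge of the best such walk from
`w` that is not among its last `a` edges. -/
theorem IsBest.notMem_edges_of_length_le {p : G.Walk w t} (hp : IsBest A p) {e : Sym2 V} {a : ℕ}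
    (he : e ∈ p.edges) (hfar : e ∉ p.edges.reverse.take a) {r : G.Walk x t} (hr : Avoids A r)
    (hlen : r.length ≤ a) : e ∉ r.edges := by
  intro her
  obtain ⟨b, c, p₁, hbc, p₂, rfl, rfl⟩ := exists_append_cons_of_mem_edges he
  obtain ⟨b', c', r₁, hbc', r₂, heq, rfl⟩ := exists_append_cons_of_mem_edges her
  have hlt : a ≤ p₂.length := by
    by_contra! hlt
    apply hfar
    rw [Walk.edges_append, Walk.edges_cons, List.reverse_append, List.reverse_cons,
      List.append_assoc, List.take_append, List.mem_append]
    right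
    obtain ⟨m, hm⟩ : ∃ m, a - p₂.edges.reverse.length = m + 1 :=
      ⟨a - p₂.length - 1, by simp; omega⟩
    rw [hm]
    simp
  have hp' := hp.of_append_right
  have hr' := (avoids_append.1 hr).2
  rw [Walk.length_append, Walk.length_cons] at hlen
  rcases Sym2.eq_iff.1 heq with ⟨rfl, rfl⟩ | ⟨rfl, rfl⟩
  · have := hp'.of_cons.length_le (avoids_cons.1 hr').2
    omega
  · have := hp'.length_le (avoids_cons.1 hr').2
    rw [Walk.length_cons] at this
    omega

/-- One step of the count of last edges. The indices in `J` name length scales `a i`. Starting from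
the best walk avoiding `A`, choose a fault `e` on it, charge it to the last scale `i ∈ J` for which
`e` is among the last `a i` edges, and go on with `A ∪ {e}` and `J ∖ {i}`. The walks reached in this
way without running out of scales number at most a constant times the product of the scales. If at
some point no scale is left for `e`, let `j` be the least remaining one: then `e` is too far from
`t` to matter to walks of length at most `a j`, and so are the faults charged to scales before `j`,
since these did not fit `j` either. Leaving all of them out of `F` gives `F'`. -/
theorem exists_penultimate_cover_or_drop [Fintype V] (t w : V) (a : ℕ → ℕ) (ha : ∀ i, 0 < a i)
    (J : Finset ℕ) : ∀ A : Finset (Sym2 V), ∃ B : Finset V,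
      B.card ≤ (J.card + 1)! * ∏ i ∈ J, a i ∧
      ∀ F : Finset (Sym2 V), A ⊆ F → (F \ A).card ≤ J.card →
        ∀ p : G.Walk w t, IsBest F p → p.penultimate ∈ B ∨
          ∃ j ∈ J, ∃ F' : Finset (Sym2 V), A ⊆ F' ∧ F' ⊆ F ∧
            F'.card + 1 + (J.filter (· < j)).card ≤ F.card ∧
            ∀ (x : V) (r : G.Walk x t), Avoids F' r → r.length ≤ a j → Avoids F r := by
  induction J using Finset.strongInduction with
  | H J ih =>
    intro A
    by_cases hex : ∃ p : G.Walk w t, IsBest A p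
    swap
    · refine ⟨∅, by simp, fun F hAF _ p hp => absurd ?_ hex⟩
      exact exists_isBest p (hp.1.mono hAF)
    obtain ⟨p₀, hp₀⟩ := hex
    choose B hBcard hB using fun (i : J) (e : Sym2 V) =>
      ih (J.erase i) (Finset.erase_ssubset i.2) (insert e A)
    refine ⟨insert p₀.penultimate (J.attach.biUnion fun i =>
      (p₀.edges.reverse.take (a i)).toFinset.biUnion fun e => B i e), ?_, ?_⟩
    · have hone : 1 ≤ ∏ i ∈ J, a i := Finset.prod_pos fun i _ => ha i
      have hterm : ∀ i ∈ J.attach, ((p₀.edges.reverse.take (a i)).toFinset.biUnion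
          fun e => B i e).card ≤ J.card ! * ∏ i ∈ J, a i := by
        rintro ⟨i, hi⟩ -
        have hpos := Finset.card_pos.2 ⟨i, hi⟩
        calc _ ≤ (p₀.edges.reverse.take (a i)).toFinset.card *
              (J.card ! * ∏ i ∈ J.erase i, a i) := by
              refine Finset.card_biUnion_le_card_mul _ _ _ fun e _ => ?_
              have := hBcard ⟨i, hi⟩ e
              rwa [Finset.card_erase_of_mem hi, Nat.sub_add_cancel hpos] at this
          _ ≤ a i * (J.card ! * ∏ i ∈ J.erase i, a i) := by
              gcongr
              exact (List.toFinset_card_le _).trans (by simp)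
          _ = _ := by rw [← Finset.mul_prod_erase J a hi]; ring
      calc _ ≤ J.attach.card * (J.card ! * ∏ i ∈ J, a i) + 1 :=
            (Finset.card_insert_le _ _).trans
              (Nat.succ_le_succ (Finset.card_biUnion_le_card_mul _ _ _ hterm))
        _ ≤ J.card * (J.card ! * ∏ i ∈ J, a i) + J.card ! * ∏ i ∈ J, a i := by
            rw [Finset.card_attach]
            gcongr
            exact Nat.mul_pos (Nat.factorial_pos _) hone
        _ = _ := by rw [Nat.factorial_succ]; ring
    · intro F hAF hcard p hp
      by_cases hfault : ∃ e ∈ p₀.edges, e ∈ F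
      swap
      · left
        push Not at hfault
        rw [hp.unique (hp₀.of_avoids_superset hAF hfault)]
        exact Finset.mem_insert_self _ _
      obtain ⟨e, he₀, heF⟩ := hfault
      have heA := hp₀.1 e he₀
      rcases (J.filter fun i => e ∈ p₀.edges.reverse.take (a i)).eq_empty_or_nonempty
        with hI | hI
      · right
        have hJ : J.Nonempty := by
          rw [← Finset.card_pos]
          exact (Finset.card_pos.2 ⟨e, Finset.mem_sdiff.2 ⟨heF, heA⟩⟩).trans_le hcard
        have hmin := J.min'_mem hJ
        refine ⟨J.min' hJ, hmin, F.erase e, Finset.subset_erase.2 ⟨hAF, heA⟩,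
          Finset.erase_subset _ _, ?_, fun x r hr hlen => ?_⟩
        · rw [Finset.card_erase_add_one heF, Finset.filter_false_of_mem]
          · simp
          · exact fun i hi => not_lt.2 (J.min'_le i hi)
        · have hfar : e ∉ p₀.edges.reverse.take (a (J.min' hJ)) := fun h => by
            have : J.min' hJ ∈ J.filter fun i => e ∈ p₀.edges.reverse.take (a i) :=
              Finset.mem_filter.2 ⟨hmin, h⟩
            rw [hI] at this
            simp at this
          rw [← Finset.insert_erase heF, avoids_insert]
          exact ⟨hp₀.notMem_edges_of_length_le he₀ hfar
            (hr.mono (Finset.subset_erase.2 ⟨hAF, heA⟩)) hlen, hr⟩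
      · have himem := Finset.max'_mem _ hI
        have himax : ∀ j ∈ J.filter fun i => e ∈ p₀.edges.reverse.take (a i),
            j ≤ (J.filter fun i => e ∈ p₀.edges.reverse.take (a i)).max' hI :=
          fun j hj => Finset.le_max' _ j hj
        generalize (J.filter fun i => e ∈ p₀.edges.reverse.take (a i)).max' hI = i at himem himax
        obtain ⟨hiJ, hei⟩ := Finset.mem_filter.1 himem
        have hcard' : (F \ insert e A).card ≤ (J.erase i).card := by
          rw [Finset.sdiff_insert, Finset.card_erase_of_mem (Finset.mem_sdiff.2 ⟨heF, heA⟩),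
            Finset.card_erase_of_mem hiJ]
          omega
        rcases hB ⟨i, hiJ⟩ e F (Finset.insert_subset heF hAF) hcard' p hp with
          hmem | ⟨j, hj, F', hAF', hF'F, hF'card, hF'⟩
        · left
          refine Finset.mem_insert_of_mem (Finset.mem_biUnion.2 ⟨⟨i, hiJ⟩, Finset.mem_attach _ _,
            Finset.mem_biUnion.2 ⟨e, List.mem_toFinset.2 hei, hmem⟩⟩)
        · right
          obtain ⟨hji, hjJ⟩ := Finset.mem_erase.1 hj
          obtain ⟨heF', hAF''⟩ := Finset.insert_subset_iff.1 hAF'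
          rw [Finset.filter_erase] at hF'card
          change F'.card + 1 + ((J.filter (· < j)).erase i).card ≤ F.card at hF'card
          rcases lt_or_gt_of_ne hji with hlt | hgt
          · refine ⟨j, hjJ, F', hAF'', hF'F, ?_, hF'⟩
            rwa [Finset.erase_eq_of_notMem (by simp [hlt.le])] at hF'card
          · refine ⟨j, hjJ, F'.erase e, Finset.subset_erase.2 ⟨hAF'', heA⟩,
              (Finset.erase_subset _ _).trans hF'F, ?_, fun x r hr hlen => hF' x r ?_ hlen⟩
            · have hi' : i ∈ J.filter (· < j) := Finset.mem_filter.2 ⟨hiJ, hgt⟩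
              have h1 := Finset.card_erase_add_one hi'
              have h2 := Finset.card_erase_add_one heF'
              omega
            · have hfar : e ∉ p₀.edges.reverse.take (a j) := fun h =>
                (himax j (Finset.mem_filter.2 ⟨hjJ, h⟩)).not_gt hgt
              rw [← Finset.insert_erase heF', avoids_insert]
              exact ⟨hp₀.notMem_edges_of_length_le he₀ hfar
                (hr.mono (Finset.subset_erase.2 ⟨hAF'', heA⟩)) hlen, hr⟩

/-- Let `W j` meet the last `a j` vertices before `t` of every best walk to `t` that has that many.
Then the penultimate vertices of the best walks from `s` to `t` are among those counted by
`exists_penultimate_cover_or_drop` from the vertices of `W j`, with the scales after `j`: whenever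
faults can be dropped for walks of length at most `a j`, either the whole walk is that short, or
its part from a vertex of `W j` is, and that part stays best after the faults are dropped. -/
theorem exists_penultimate_cover_of_hitting [Fintype V] (s t : V) (f : ℕ) (a : ℕ → ℕ)
    (ha : ∀ i, 0 < a i) (W : ℕ → Finset V) (hs : s ∈ W 0)
    (hW : ∀ j, 0 < j → j ≤ f → ∀ F : Finset (Sym2 V), F.card ≤ f → ∀ (x : V) (p : G.Walk x t),
      IsBest F p → a j ≤ p.length → ∃ y ∈ W j, ∃ (p₁ : G.Walk x y) (p₂ : G.Walk y t),
        p = p₁.append p₂ ∧ ¬ p₂.Nil ∧ p₂.length ≤ a j) :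
    ∃ E : Finset V,
      E.card ≤ ∑ j ∈ Finset.range (f + 1),
        (W j).card * ((f - j + 1)! * ∏ i ∈ Finset.Ioc j f, a i) ∧
      ∀ F : Finset (Sym2 V), F.card ≤ f → ∀ p : G.Walk s t, IsBest F p → p.penultimate ∈ E := by
  choose B hBcard hB using fun (j : ℕ) (w : V) =>
    exists_penultimate_cover_or_drop (G := G) t w a ha (Finset.Ioc j f) ∅
  refine ⟨(Finset.range (f + 1)).biUnion fun j => (W j).biUnion fun w => B j w, ?_, ?_⟩
  · refine Finset.card_biUnion_le.trans (Finset.sum_le_sum fun j _ => ?_)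
    refine Finset.card_biUnion_le_card_mul _ _ _ fun w _ => ?_
    simpa using hBcard j w
  suffices h : ∀ (m : ℕ) (F : Finset (Sym2 V)), F.card = m → ∀ j, F.card + j ≤ f → ∀ w ∈ W j,
      ∀ p : G.Walk w t, IsBest F p → p.penultimate ∈
        (Finset.range (f + 1)).biUnion fun j => (W j).biUnion fun w => B j w from
    fun F hF p hp => h _ F rfl 0 (by simpa using hF) s hs p hp
  intro m
  induction m using Nat.strong_induction_on with
  | _ m ih =>
    rintro F rfl j hj w hw p hp
    rcases hB j w F (Finset.empty_subset _) (by simp; omega) p hp with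
      hmem | ⟨i, hi, F', -, hF'F, hcard, hF'⟩
    · exact Finset.mem_biUnion.2 ⟨j, by simp; omega, Finset.mem_biUnion.2 ⟨w, hw, hmem⟩⟩
    obtain ⟨hji, hif⟩ := Finset.mem_Ioc.1 hi
    have hbest : ∀ (y : V) (r : G.Walk y t), IsBest F r → r.length ≤ a i → IsBest F' r := by
      refine fun y r hr hlen => ⟨hr.1.mono hF'F, fun q hq => ?_⟩
      rcases le_or_gt q.length (a i) with hle | hgt
      · exact hr.2 q (hF' y q hq hle)
      · exact (walkWeight_lt_of_length_lt (hlen.trans_lt hgt)).le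
    have hfilter : (Finset.Ioc j f).filter (· < i) = Finset.Ioo j i := by
      ext k
      simp only [Finset.mem_filter, Finset.mem_Ioc, Finset.mem_Ioo]
      omega
    rw [hfilter, Nat.card_Ioo] at hcard
    rcases le_or_gt p.length (a i) with hle | hgt
    · exact ih _ (by omega) F' rfl j (by omega) w hw p (hbest w p hp hle)
    · obtain ⟨y, hy, p₁, p₂, rfl, hnil, hlen⟩ :=
        hW i (by omega) hif F (by omega) w p hp hgt.le
      rw [penultimate_append_of_not_nil p₁ hnil]
      exact ih _ (by omega) F' rfl i (by omega) y hy p₂ (hbest y p₂ hp.of_append_right hlen)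

end Cover

/-! ### Hitting sets -/

/-- Greedily choosing elements that lie in as many of the remaining sets as possible: each choice
leaves at most the fraction `1 - a / |α|` of the sets. -/
theorem exists_card_le_card_filter_disjoint_le {α : Type*} [Fintype α] [DecidableEq α]
    (𝓕 : Finset (Finset α)) {a : ℕ} (haα : a ≤ Fintype.card α) (hα : 0 < Fintype.card α)
    (h : ∀ S ∈ 𝓕, a ≤ S.card) (k : ℕ) :
    ∃ W : Finset α, W.card ≤ k ∧
      ((𝓕.filter (Disjoint · W)).card : ℝ) ≤ 𝓕.card * (1 - a / Fintype.card α) ^ k := by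
  have hα' : (0 : ℝ) < Fintype.card α := by exact_mod_cast hα
  have hfrac : 0 ≤ 1 - (a : ℝ) / Fintype.card α := by
    rw [sub_nonneg, div_le_one hα']
    exact_mod_cast haα
  induction k with
  | zero => exact ⟨∅, by simp⟩
  | succ k ih =>
    obtain ⟨W, hWcard, hW⟩ := ih
    set U := 𝓕.filter (Disjoint · W) with hU
    have hdouble : ∑ x : α, (U.filter (x ∈ ·)).card = ∑ S ∈ U, S.card := by
      have := Finset.sum_card_bipartiteAbove_eq_sum_card_bipartiteBelow
        (s := (Finset.univ : Finset α)) (t := U) (fun x S => x ∈ S)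
      simpa [Finset.bipartiteAbove, Finset.bipartiteBelow] using this
    have hsum : a * U.card ≤ ∑ x : α, (U.filter (x ∈ ·)).card := by
      rw [hdouble, mul_comm, ← smul_eq_mul]
      exact Finset.card_nsmul_le_sum _ _ _ fun S hS => h S (Finset.mem_filter.1 hS).1
    obtain ⟨x, hx⟩ : ∃ x : α, a * U.card ≤ Fintype.card α * (U.filter (x ∈ ·)).card := by
      by_contra! hcon
      have : Nonempty α := Fintype.card_pos_iff.1 hα
      have h1 : ∑ x : α, Fintype.card α * (U.filter (x ∈ ·)).card <
          ∑ x : α, a * U.card := Finset.sum_lt_sum_of_nonempty Finset.univ_nonempty fun x _ => hcon x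
      rw [← Finset.mul_sum, Finset.sum_const, smul_eq_mul, Finset.card_univ] at h1
      exact absurd hsum (Nat.lt_of_mul_lt_mul_left h1).not_ge
    refine ⟨insert x W, (Finset.card_insert_le _ _).trans (by omega), ?_⟩
    have hsub : 𝓕.filter (Disjoint · (insert x W)) = U.filter (x ∉ ·) := by
      ext S
      simp only [hU, Finset.mem_filter, Finset.disjoint_insert_right]
      tauto
    have hsplit := Finset.card_filter_add_card_filter_not (s := U) (x ∈ ·)
    have hsplit' : ((U.filter (x ∈ ·)).card : ℝ) + (U.filter (x ∉ ·)).card = U.card := by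
      exact_mod_cast hsplit
    have hx' : (a : ℝ) * U.card ≤ Fintype.card α * (U.filter (x ∈ ·)).card := by exact_mod_cast hx
    have hx'' : (a : ℝ) / Fintype.card α * U.card ≤ (U.filter (x ∈ ·)).card := by
      rw [div_mul_eq_mul_div, div_le_iff₀ hα']
      linarith
    rw [hsub]
    calc ((U.filter (x ∉ ·)).card : ℝ) ≤ U.card * (1 - a / Fintype.card α) := by linarith
      _ ≤ 𝓕.card * (1 - a / Fintype.card α) ^ k * (1 - a / Fintype.card α) := by gcongr
      _ = _ := by ring

/-- A family of at most `M` sets of size at least `a` is hit by about `(|α| / a) log M` elements. -/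
theorem exists_hitting_set {α : Type*} [Fintype α] [DecidableEq α] (𝓕 : Finset (Finset α)) {a : ℕ}
    (ha : 0 < a) (h : ∀ S ∈ 𝓕, a ≤ S.card) {M : ℝ} (hM : 1 ≤ M) (hcard : (𝓕.card : ℝ) ≤ M) :
    ∃ W : Finset α, (W.card : ℝ) ≤ Fintype.card α / a * Real.log M + 1 ∧
      ∀ S ∈ 𝓕, ∃ x ∈ S, x ∈ W := by
  have hlog := Real.log_nonneg hM
  rcases 𝓕.eq_empty_or_nonempty with rfl | ⟨S, hS⟩
  · exact ⟨∅, by simp; positivity, by simp⟩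
  have haα : a ≤ Fintype.card α := (h S hS).trans (Finset.card_le_univ S)
  have ha' : (0 : ℝ) < a := by exact_mod_cast ha
  have hα' : (0 : ℝ) < Fintype.card α := by exact_mod_cast ha.trans_le haα
  obtain ⟨W, hWcard, hW⟩ := exists_card_le_card_filter_disjoint_le 𝓕 haα (ha.trans_le haα) h
    (⌊Fintype.card α / a * Real.log M⌋₊ + 1)
  refine ⟨W, (Nat.cast_le.2 hWcard).trans ?_, fun S hS => ?_⟩
  · push_cast
    gcongr
    exact Nat.floor_le (by positivity)
  · set k := ⌊Fintype.card α / a * Real.log M⌋₊ + 1 with hk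
    have hklt : Fintype.card α / a * Real.log M < k := by
      rw [hk]; push_cast; exact Nat.lt_floor_add_one _
    have hlt : ((𝓕.filter (Disjoint · W)).card : ℝ) < 1 := by
      calc _ ≤ (𝓕.card : ℝ) * (1 - a / Fintype.card α) ^ k := hW
        _ ≤ M * Real.exp (-(a / Fintype.card α)) ^ k := by
          have hfrac : 0 ≤ 1 - (a : ℝ) / Fintype.card α := by
            rw [sub_nonneg, div_le_one hα']
            exact_mod_cast haα
          gcongr
          exact Real.one_sub_le_exp_neg _
        _ = Real.exp (Real.log M - k * (a / Fintype.card α)) := by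
          rw [← Real.exp_nat_mul, Real.exp_sub, Real.exp_log (by linarith), mul_neg, Real.exp_neg]
          rfl
        _ < 1 := by
          rw [Real.exp_lt_one_iff, sub_neg]
          rw [div_mul_eq_mul_div, div_lt_iff₀ ha'] at hklt
          rw [← mul_div_assoc, lt_div_iff₀ hα']
          linarith
    have hzero : (𝓕.filter (Disjoint · W)).card = 0 := by
      exact_mod_cast Nat.lt_one_iff.1 (by exact_mod_cast hlt)
    have hnot : ¬ Disjoint S W := fun hd => by
      have : S ∈ 𝓕.filter (Disjoint · W) := Finset.mem_filter.2 ⟨hS, hd⟩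
      rw [Finset.card_eq_zero.1 hzero] at this
      simp at this
    exact Finset.not_disjoint_iff.1 hnot

theorem card_filter_card_le (α : Type*) [Fintype α] [DecidableEq α] (f : ℕ) :
    ((Finset.univ : Finset (Finset α)).filter (·.card ≤ f)).card ≤ (Fintype.card α + 1) ^ f := by
  have hsub : (Finset.univ : Finset (Finset α)).filter (·.card ≤ f) ⊆
      (Finset.range (f + 1)).biUnion fun k => Finset.powersetCard k Finset.univ := by
    intro S hS
    rw [Finset.mem_filter] at hS
    simp only [Finset.mem_biUnion, Finset.mem_range, Finset.mem_powersetCard_univ]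
    exact ⟨_, by omega, rfl⟩
  refine ((Finset.card_le_card hsub).trans Finset.card_biUnion_le).trans ?_
  rw [add_pow]
  refine Finset.sum_le_sum fun k hk => ?_
  rw [Finset.card_powersetCard, Finset.card_univ, one_pow, mul_one]
  calc _ ≤ Fintype.card α ^ k := Nat.choose_le_pow _ _
    _ ≤ _ := Nat.le_mul_of_pos_right _ (Nat.choose_pos (by simpa [Nat.lt_succ_iff] using hk))

/-! ### The choice of scales -/

theorem exists_append_at_getVert {V : Type*} {G : SimpleGraph V} {u v : V} (p : G.Walk u v) :
    ∀ i ≤ p.length, ∃ (p₁ : G.Walk u (p.getVert i)) (p₂ : G.Walk (p.getVert i) v),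
      p = p₁.append p₂ ∧ p₂.length = p.length - i := by
  induction p with
  | nil => exact fun i _ => ⟨Walk.nil, Walk.nil, rfl, by simp⟩
  | cons h p ih =>
    rintro (_ | i) hi
    · exact ⟨Walk.nil, Walk.cons h p, rfl, rfl⟩
    · obtain ⟨p₁, p₂, hp, hlen⟩ := ih i (by simpa using hi)
      refine ⟨Walk.cons h p₁, p₂, congrArg (Walk.cons h) hp, hlen.trans ?_⟩
      rw [Walk.length_cons, Nat.add_sub_add_right]

section Count

variable {V : Type*} [LinearOrder V] [Fintype V] (G : SimpleGraph V)

theorem exists_hitting_set_of_isBest (t : V) (f : ℕ) {a : ℕ} (ha : 0 < a) :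
    ∃ W : Finset V,
      (W.card : ℝ) ≤ Fintype.card V / a * ((2 * f + 1) * Real.log (Fintype.card V + 2)) + 1 ∧
      ∀ F : Finset (Sym2 V), F.card ≤ f → ∀ (x : V) (p : G.Walk x t),
        IsBest F p → a ≤ p.length → ∃ y ∈ W, ∃ (p₁ : G.Walk x y) (p₂ : G.Walk y t),
          p = p₁.append p₂ ∧ ¬ p₂.Nil ∧ p₂.length ≤ a := by
  classical
  -- The last `a` vertices before `t` of the best walk from `x` avoiding `F`.
  let S : V × Finset (Sym2 V) → Finset V := fun z =>
    Finset.univ.filter fun y => ∃ p : G.Walk z.1 t, IsBest z.2 p ∧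
      ∃ (p₁ : G.Walk z.1 y) (p₂ : G.Walk y t), p = p₁.append p₂ ∧ ¬ p₂.Nil ∧ p₂.length ≤ a
  let Z : Finset (V × Finset (Sym2 V)) := Finset.univ ×ˢ Finset.univ.filter (·.card ≤ f)
  have hcardS : ∀ (x : V) (F : Finset (Sym2 V)) (p : G.Walk x t), IsBest F p → a ≤ p.length →
      a ≤ (S (x, F)).card := by
    intro x F p hp hlen
    have hinj : Set.InjOn p.getVert (Finset.Ico (p.length - a) p.length : Finset ℕ) :=
      hp.isPath.getVert_injOn.mono fun i hi => (Finset.mem_Ico.1 hi).2.le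
    have hcard := Finset.card_image_of_injOn hinj
    rw [Nat.card_Ico, Nat.sub_sub_self hlen] at hcard
    rw [← hcard]
    refine Finset.card_le_card fun y hy => ?_
    obtain ⟨i, hi, rfl⟩ := Finset.mem_image.1 hy
    obtain ⟨hi1, hi2⟩ := Finset.mem_Ico.1 hi
    obtain ⟨p₁, p₂, hp₁₂, hp₂⟩ := exists_append_at_getVert p i hi2.le
    refine Finset.mem_filter.2 ⟨Finset.mem_univ _, p, hp, p₁, p₂, hp₁₂, ?_, by omega⟩
    rw [Walk.not_nil_iff_lt_length]
    omega
  have hZ : (((Z.image S).filter (a ≤ ·.card)).card : ℝ) ≤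
      ((Fintype.card V : ℝ) + 2) ^ (2 * f + 1) := by
    have h1 : ((Z.image S).filter (a ≤ ·.card)).card ≤
        Fintype.card V * (Fintype.card (Sym2 V) + 1) ^ f := by
      refine (Finset.card_filter_le _ _).trans (Finset.card_image_le.trans ?_)
      rw [Finset.card_product, Finset.card_univ]
      exact Nat.mul_le_mul_left _ (card_filter_card_le _ f)
    have h2 : Fintype.card (Sym2 V) + 1 ≤ (Fintype.card V + 2) ^ 2 := by
      rw [Sym2.card]
      have := Nat.choose_le_pow (Fintype.card V + 1) 2
      nlinarith
    have h3 : ((Z.image S).filter (a ≤ ·.card)).card ≤ (Fintype.card V + 2) ^ (2 * f + 1) := by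
      calc _ ≤ Fintype.card V * (Fintype.card (Sym2 V) + 1) ^ f := h1
        _ ≤ (Fintype.card V + 2) * ((Fintype.card V + 2) ^ 2) ^ f := by
          gcongr
          omega
        _ = _ := by rw [← pow_mul, pow_succ, mul_comm]
    exact_mod_cast h3
  obtain ⟨W, hWcard, hW⟩ := exists_hitting_set ((Z.image S).filter (a ≤ ·.card)) ha
    (fun T hT => (Finset.mem_filter.1 hT).2) (one_le_pow₀ (by
      have : (0 : ℝ) ≤ Fintype.card V := by positivity
      linarith)) hZ
  refine ⟨W, ?_, fun F hF x p hp hlen => ?_⟩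
  · rw [Real.log_pow] at hWcard
    push_cast at hWcard
    exact hWcard
  · obtain ⟨y, hyS, hyW⟩ := hW (S (x, F)) (Finset.mem_filter.2 ⟨Finset.mem_image_of_mem _
      (Finset.mem_product.2 ⟨Finset.mem_univ _, Finset.mem_filter.2 ⟨Finset.mem_univ _, hF⟩⟩),
      hcardS x F p hp hlen⟩)
    obtain ⟨-, p', hp', h⟩ := Finset.mem_filter.1 hyS
    rw [hp'.unique hp] at h
    exact ⟨y, hyW, h⟩

theorem mul_prod_pow_two_pow (A f k : ℕ) : ∀ j, j + k = f →
    A * ∏ i ∈ Finset.Ioc j f, A ^ 2 ^ (f - i) = A ^ 2 ^ (f - j) := by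
  induction k with
  | zero =>
    rintro j rfl
    simp
  | succ k ih =>
    intro j hj
    have hIoc : Finset.Ioc j f = insert (j + 1) (Finset.Ioc (j + 1) f) := by
      ext i
      simp only [Finset.mem_insert, Finset.mem_Ioc]
      omega
    rw [hIoc, Finset.prod_insert (by simp), mul_left_comm, ih (j + 1) (by omega), ← pow_add,
      show f - j = f - (j + 1) + 1 by omega, pow_succ 2]
    congr 1
    ring

/-- The scales are `a i = A ^ 2 ^ (f - i)` with `A` about `n ^ (1 / 2 ^ f)`, so that `a i` is about
`n ^ (1 / 2 ^ i)`. About `n / a j` vertices hit the walks of length `a j`, and the product of the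
scales after `j` is `a j / A`: each `j` contributes about `n / A` penultimate vertices. -/
theorem exists_penultimate_cover (f : ℕ) (s t : V) :
    ∃ E : Finset V, (E.card : ℝ) ≤ ((f + 1) * (f + 1)! * (2 * f + 1 + 2 ^ 2 ^ f)) *
        (Fintype.card V : ℝ) ^ (1 - 1 / (2 : ℝ) ^ f) * Real.log (Fintype.card V + 2) ∧
      ∀ F : Finset (Sym2 V), F.card ≤ f → ∀ p : G.Walk s t, IsBest F p → p.penultimate ∈ E := by
  have hn : 1 ≤ Fintype.card V := Fintype.card_pos_iff.2 ⟨s⟩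
  set n := Fintype.card V with hn_def
  have hn' : (1 : ℝ) ≤ n := by exact_mod_cast hn
  set L := Real.log ((n : ℝ) + 2) with hL
  have hL1 : 1 ≤ L := by
    rw [hL, Real.le_log_iff_exp_le (by linarith)]
    linarith [Real.exp_one_lt_d9]
  set r := (n : ℝ) ^ (1 / (2 : ℝ) ^ f) with hr
  have hr1 : 1 ≤ r := Real.one_le_rpow hn' (by positivity)
  have hrpow : r ^ 2 ^ f = n := by
    rw [hr, ← Real.rpow_natCast, ← Real.rpow_mul (by linarith)]
    push_cast
    rw [one_div_mul_cancel (by positivity), Real.rpow_one]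
  have hnr : (n : ℝ) ^ (1 - 1 / (2 : ℝ) ^ f) = n / r := by
    rw [Real.rpow_sub (by linarith), Real.rpow_one]
  set A := ⌈r⌉₊ with hA
  have hrA : r ≤ A := Nat.le_ceil r
  have hA2 : (A : ℝ) ≤ 2 * r := by
    have := Nat.ceil_lt_add_one (zero_le_one.trans hr1)
    linarith
  have hApos : 0 < A := Nat.ceil_pos.2 (by linarith)
  have hA1 : (1 : ℝ) ≤ A := hr1.trans hrA
  choose W hWcard hW using fun j : ℕ =>
    exists_hitting_set_of_isBest G t f (a := A ^ 2 ^ (f - j)) (by positivity)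
  obtain ⟨E, hE, hEmem⟩ := exists_penultimate_cover_of_hitting (G := G) s t f
    (fun j => A ^ 2 ^ (f - j)) (fun j => by positivity)
    (fun j => if j = 0 then {s} else W j) (by simp)
    (fun j hj _ F hF x p hp hlen => by
      simp only [if_neg hj.ne']
      exact hW j F hF x p hp hlen)
  refine ⟨E, ?_, hEmem⟩
  have hWle : ∀ j, (((if j = 0 then {s} else W j : Finset V)).card : ℝ) ≤
      n / ((A ^ 2 ^ (f - j) : ℕ) : ℝ) * ((2 * f + 1) * L) + 1 := by
    intro j
    split_ifs with hj
    · rw [Finset.card_singleton, Nat.cast_one]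
      have : 0 ≤ (n : ℝ) / ((A ^ 2 ^ (f - j) : ℕ) : ℝ) * ((2 * f + 1) * L) := by positivity
      linarith
    · exact hWcard j
  have hterm : ∀ j ∈ Finset.range (f + 1),
      (((if j = 0 then {s} else W j : Finset V)).card : ℝ) *
        (((f - j + 1)! : ℕ) * ((∏ i ∈ Finset.Ioc j f, A ^ 2 ^ (f - i) : ℕ) : ℝ)) ≤
      (f + 1)! * ((2 * f + 1 + 2 ^ 2 ^ f) * (n / r) * L) := by
    intro j hj
    have hjf : j ≤ f := by simpa [Nat.lt_succ_iff] using hj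
    have hprod := mul_prod_pow_two_pow A f (f - j) j (by omega)
    set P := ∏ i ∈ Finset.Ioc j f, A ^ 2 ^ (f - i)
    have hprod' : (A : ℝ) * P = (A ^ 2 ^ (f - j) : ℕ) := by exact_mod_cast hprod
    set a := A ^ 2 ^ (f - j) with ha
    have hapos : (0 : ℝ) < a := by
      have : 0 < a := by positivity
      exact_mod_cast this
    have hale : (a : ℝ) ≤ 2 ^ 2 ^ f * n := by
      calc (a : ℝ) = (A : ℝ) ^ 2 ^ (f - j) := by rw [ha]; push_cast; rfl
        _ ≤ (A : ℝ) ^ 2 ^ f :=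
          pow_le_pow_right₀ hA1 (Nat.pow_le_pow_right (by norm_num) (Nat.sub_le _ _))
        _ ≤ (2 * r) ^ 2 ^ f := by gcongr
        _ = _ := by rw [mul_pow, hrpow]
    have hmain : (((if j = 0 then {s} else W j : Finset V)).card : ℝ) * P ≤
        (2 * f + 1 + 2 ^ 2 ^ f) * (n / r) * L := by
      have hP : (P : ℝ) = a / A := by
        rw [eq_div_iff (by positivity), ← hprod', mul_comm]
      calc _ ≤ (n / (a : ℝ) * ((2 * f + 1) * L) + 1) * P := by
            gcongr
            exact hWle j
        _ = (n * ((2 * f + 1) * L) + a) / A := by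
            rw [hP]
            field_simp
        _ ≤ (n * ((2 * f + 1) * L) + 2 ^ 2 ^ f * n * L) / r := by
            gcongr
            exact hale.trans (le_mul_of_one_le_right (by positivity) hL1)
        _ = _ := by ring
    have hfact : (((f - j + 1)! : ℕ) : ℝ) ≤ (f + 1)! := by
      exact_mod_cast Nat.factorial_le (by omega)
    calc _ = (((f - j + 1)! : ℕ) : ℝ) *
          ((((if j = 0 then {s} else W j : Finset V)).card : ℝ) * P) := by ring
      _ ≤ _ := by gcongr
  have hEle : (E.card : ℝ) ≤ ∑ j ∈ Finset.range (f + 1),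
      (((if j = 0 then {s} else W j : Finset V)).card : ℝ) *
        (((f - j + 1)! : ℕ) * ((∏ i ∈ Finset.Ioc j f, A ^ 2 ^ (f - i) : ℕ) : ℝ)) := by
    exact_mod_cast hE
  refine (hEle.trans (Finset.sum_le_sum hterm)).trans (le_of_eq ?_)
  rw [Finset.sum_const, Finset.card_range, nsmul_eq_mul, hnr]
  push_cast
  ring

end Count

/-! ### The preserver of a vertex -/

section Preserver

variable {V : Type*} [LinearOrder V] [Fintype V] (G : SimpleGraph V)

open Classical in
/-- The last arcs of the best walks from `s` that avoid at most `f` faults. Parts of best walks are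
best, so these are all arcs of such walks. -/
noncomputable def preserverArcs (f : ℕ) (s : V) : Finset (V × V) :=
  Finset.univ.filter fun z => ∃ F : Finset (Sym2 V), F.card ≤ f ∧
    ∃ p : G.Walk s z.2, IsBest F p ∧ ¬ p.Nil ∧ p.penultimate = z.1

variable {G} {f : ℕ} {s t : V} {F : Finset (Sym2 V)}

theorem mem_preserverArcs {z : V × V} : z ∈ preserverArcs G f s ↔
    ∃ F : Finset (Sym2 V), F.card ≤ f ∧
      ∃ p : G.Walk s z.2, IsBest F p ∧ ¬ p.Nil ∧ p.penultimate = z.1 := by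
  simp [preserverArcs]

theorem adj_of_mem_preserverArcs {z : V × V} (hz : z ∈ preserverArcs G f s) : G.Adj z.1 z.2 := by
  obtain ⟨F, -, p, -, hnil, hpen⟩ := mem_preserverArcs.1 hz
  rw [← hpen]
  exact Walk.adj_penultimate hnil

theorem IsBest.exists_mem_preserverArcs (hF : F.card ≤ f) {p : G.Walk s t} (hp : IsBest F p)
    {e : Sym2 V} (he : e ∈ p.edges) : ∃ z ∈ preserverArcs G f s, e = s(z.1, z.2) := by
  obtain ⟨a, b, p₁, h, p₂, rfl, rfl⟩ := exists_append_cons_of_mem_edges he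
  refine ⟨(a, b), mem_preserverArcs.2 ⟨F, hF, p₁.concat h, ?_, ?_, ?_⟩, rfl⟩
  · rw [← Walk.concat_append] at hp
    exact hp.of_append_left
  · rw [Walk.not_nil_iff_lt_length, Walk.length_concat]
    omega
  · exact Walk.penultimate_concat _ _

theorem card_preserverArcs_le (f : ℕ) (s : V) :
    ((preserverArcs G f s).card : ℝ) ≤ ((f + 1) * (f + 1)! * (2 * f + 1 + 2 ^ 2 ^ f)) *
      (Fintype.card V : ℝ) ^ (2 - 1 / (2 : ℝ) ^ f) * Real.log (Fintype.card V + 2) := by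
  choose E hE hEmem using exists_penultimate_cover G f s
  have hsub : preserverArcs G f s ⊆
      Finset.univ.biUnion fun t => (E t).image fun u => (u, t) := by
    intro z hz
    obtain ⟨F, hF, p, hp, -, hpen⟩ := mem_preserverArcs.1 hz
    refine Finset.mem_biUnion.2 ⟨z.2, Finset.mem_univ _, Finset.mem_image.2 ⟨z.1, ?_, rfl⟩⟩
    rw [← hpen]
    exact hEmem z.2 F hF p hp
  have hn : (0 : ℝ) < Fintype.card V := by exact_mod_cast Fintype.card_pos_iff.2 ⟨s⟩
  have hcard : ((preserverArcs G f s).card : ℝ) ≤ ∑ t : V, ((E t).card : ℝ) := by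
    have h := (Finset.card_le_card hsub).trans (Finset.card_biUnion_le.trans
      (Finset.sum_le_sum fun t _ => Finset.card_image_le))
    exact_mod_cast h
  refine (hcard.trans (Finset.sum_le_sum fun t _ => hE t)).trans (le_of_eq ?_)
  rw [Finset.sum_const, Finset.card_univ, nsmul_eq_mul,
    show (2 : ℝ) - 1 / 2 ^ f = 1 + (1 - 1 / 2 ^ f) by ring, Real.rpow_add hn, Real.rpow_one]
  ring

/-- The preservers of `s` and `t` for `f` faults together preserve the distance of `s` and `t` under
`f + 1` faults. -/
theorem exists_walk_preserverArcs (hF : F.card ≤ f + 1) (q : G.Walk s t) (hq : Avoids F q) :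
    ∃ r : G.Walk s t, Avoids F r ∧ r.length ≤ q.length ∧
      ∀ e ∈ r.edges, ∃ z, (z ∈ preserverArcs G f s ∨ z ∈ preserverArcs G f t) ∧
        e = s(z.1, z.2) := by
  rcases F.eq_empty_or_nonempty with rfl | ⟨e, he⟩
  · obtain ⟨p, hp⟩ := exists_isBest q hq
    refine ⟨p, hp.1, hp.length_le hq, fun e he => ?_⟩
    obtain ⟨z, hz, rfl⟩ := hp.exists_mem_preserverArcs (f := f) (by simp) he
    exact ⟨z, Or.inl hz, rfl⟩
  · obtain ⟨q₀, hq₀⟩ := exists_isBest q hq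
    obtain ⟨x, p, p', hp, hp', hep, hep', hlen⟩ :=
      exists_isBest_append_of_shortest (F := F.erase e) (e := e) q₀
        (by rw [Finset.insert_erase he]; exact hq₀.1)
        (fun r hr => hq₀.length_le (by rwa [Finset.insert_erase he] at hr))
    have hcard : (F.erase e).card ≤ f := by
      rw [Finset.card_erase_of_mem he]
      omega
    refine ⟨p.append p'.reverse, ?_, ?_, fun d hd => ?_⟩
    · rw [← Finset.insert_erase he, avoids_append, avoids_reverse]
      exact ⟨avoids_insert.2 ⟨hep, hp.1⟩, avoids_insert.2 ⟨hep', hp'.1⟩⟩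
    · rw [Walk.length_append, Walk.length_reverse]
      exact hlen.trans (hq₀.length_le hq)
    · rw [Walk.edges_append, Walk.edges_reverse, List.mem_append, List.mem_reverse] at hd
      rcases hd with hd | hd
      · obtain ⟨z, hz, rfl⟩ := hp.exists_mem_preserverArcs hcard hd
        exact ⟨z, Or.inl hz, rfl⟩
      · obtain ⟨z, hz, rfl⟩ := hp'.exists_mem_preserverArcs hcard hd
        exact ⟨z, Or.inr hz, rfl⟩

end Preserver

/-! ### Bitstrings -/

/-- A prefix-free code for bitstrings: each bit is preceded by `true`, and the end is marked by
`false`. -/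
def encodeBits : List Bool → List Bool
  | [] => [false]
  | b :: l => true :: b :: encodeBits l

theorem length_encodeBits (l : List Bool) : (encodeBits l).length = 2 * l.length + 1 := by
  induction l with
  | nil => rfl
  | cons b l ih => simp only [encodeBits, List.length_cons, ih]; ring

theorem encodeBits_append_inj {l l' r r' : List Bool}
    (h : encodeBits l ++ r = encodeBits l' ++ r') : l = l' ∧ r = r' := by
  induction l generalizing l' with
  | nil => cases l' <;> simp_all [encodeBits]
  | cons b l ih =>
    cases l' with
    | nil => simp [encodeBits] at h
    | cons b' l' =>
      simp only [encodeBits, List.cons_append, List.cons.injEq, true_and] at h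
      obtain ⟨rfl, rfl⟩ := ih h.2
      exact ⟨by rw [h.1], rfl⟩

/-- A list of natural numbers as a bitstring. -/
def encodeNats (l : List ℕ) : List Bool := l.flatMap fun x => encodeBits x.bits

theorem natBits_injective : Function.Injective Nat.bits := by
  intro x y h
  have := congrArg (List.map fun b => cond b 1 0) h
  rw [← Nat.digits_two_eq_bits, ← Nat.digits_two_eq_bits] at this
  exact Nat.digits_inj_iff.1 this

theorem encodeNats_injective : Function.Injective encodeNats := by
  intro l l' h
  induction l generalizing l' with
  | nil =>
    cases l' with
    | nil => rfl
    | cons y l' => cases hy : y.bits <;> simp [encodeNats, hy, encodeBits] at h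
  | cons x l ih =>
    cases l' with
    | nil => cases hx : x.bits <;> simp [encodeNats, hx, encodeBits] at h
    | cons y l' =>
      simp only [encodeNats, List.flatMap_cons] at h
      obtain ⟨hxy, hl⟩ := encodeBits_append_inj h
      rw [natBits_injective hxy, ih hl]

theorem length_encodeNats_le {l : List ℕ} {k : ℕ} (h : ∀ x ∈ l, x < 2 ^ k) :
    (encodeNats l).length ≤ l.length * (2 * k + 1) := by
  induction l with
  | nil => simp [encodeNats]
  | cons x l ih =>
    have hx : x.bits.length ≤ k := by
      rw [Nat.size_eq_bits_len]
      exact Nat.size_le.2 (h x List.mem_cons_self)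
    have hl := ih fun y hy => h y (List.mem_cons_of_mem _ hy)
    unfold encodeNats at hl ⊢
    rw [List.flatMap_cons, List.length_append, length_encodeBits, List.length_cons,
      Nat.add_mul l.length 1]
    omega

theorem natSize_le_log {n : ℕ} (hn : 1 ≤ n) : (n.size : ℝ) ≤ 3 * Real.log (n + 2) := by
  have hn' : (1 : ℝ) ≤ n := by exact_mod_cast hn
  have hL1 : 1 ≤ Real.log ((n : ℝ) + 2) := by
    rw [Real.le_log_iff_exp_le (by linarith)]
    linarith [Real.exp_one_lt_d9]
  obtain ⟨m, hm⟩ : ∃ m, n.size = m + 1 :=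
    Nat.exists_eq_succ_of_ne_zero (Nat.size_pos.2 hn).ne'
  have hpow : 2 ^ m ≤ n := Nat.lt_size.1 (by omega)
  have hlog : (m : ℝ) * Real.log 2 ≤ Real.log ((n : ℝ) + 2) := by
    rw [← Real.log_pow]
    refine Real.log_le_log (by positivity) ?_
    have : (2 : ℝ) ^ m ≤ n := by exact_mod_cast hpow
    linarith
  rw [hm]
  push_cast
  nlinarith [Real.log_two_gt_d9, (Nat.cast_nonneg m : (0 : ℝ) ≤ m)]

/-! ### The labeling scheme -/

/-- The label of `s`, before it is written in bits: its name, followed by the arcs of its preserver,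
each coded as one number. -/
noncomputable def natLabel (f : ℕ) {n : ℕ} (G : SimpleGraph (Fin n)) (s : Fin n) : List ℕ :=
  s :: (preserverArcs G f s).toList.map fun z => Nat.pair z.1 z.2

/-- The graph on the names of vertices whose edges are the arcs listed in two labels. -/
def labelGraph (l l' : List ℕ) : SimpleGraph ℕ :=
  SimpleGraph.fromRel fun u v => Nat.pair u v ∈ l.tail ∨ Nat.pair u v ∈ l'.tail

section Scheme

variable {f n : ℕ} {G : SimpleGraph (Fin n)} {s t : Fin n}

theorem pair_mem_natLabel_tail {u v : ℕ} : Nat.pair u v ∈ (natLabel f G s).tail ↔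
    ∃ z ∈ preserverArcs G f s, (z.1 : ℕ) = u ∧ (z.2 : ℕ) = v := by
  simp [natLabel, Nat.pair_eq_pair]

theorem labelGraph_adj {u v : ℕ} : (labelGraph (natLabel f G s) (natLabel f G t)).Adj u v ↔
    ∃ z, (z ∈ preserverArcs G f s ∨ z ∈ preserverArcs G f t) ∧
      s((z.1 : ℕ), (z.2 : ℕ)) = s(u, v) := by
  simp only [labelGraph, SimpleGraph.fromRel_adj, pair_mem_natLabel_tail, Sym2.eq_iff]
  constructor
  · rintro ⟨-, (⟨z, hz, h⟩ | ⟨z, hz, h⟩) | (⟨z, hz, h⟩ | ⟨z, hz, h⟩)⟩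
    · exact ⟨z, Or.inl hz, Or.inl h⟩
    · exact ⟨z, Or.inr hz, Or.inl h⟩
    · exact ⟨z, Or.inl hz, Or.inr h⟩
    · exact ⟨z, Or.inr hz, Or.inr h⟩
  · rintro ⟨z, hz, h⟩
    have hne : (z.1 : ℕ) ≠ z.2 := fun h0 => by
      have hadj : G.Adj z.1 z.2 := hz.elim adj_of_mem_preserverArcs adj_of_mem_preserverArcs
      exact hadj.ne (Fin.ext h0)
    rcases h with ⟨rfl, rfl⟩ | ⟨rfl, rfl⟩
    · exact ⟨hne, Or.inl (hz.imp (fun h => ⟨z, h, rfl, rfl⟩) fun h => ⟨z, h, rfl, rfl⟩)⟩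
    · exact ⟨hne.symm, Or.inr (hz.imp (fun h => ⟨z, h, rfl, rfl⟩) fun h => ⟨z, h, rfl, rfl⟩)⟩

theorem mk_val_mem_edgeSetDescription {F : Finset (Sym2 (Fin n))} {a b : Fin n} :
    s((a : ℕ), (b : ℕ)) ∈ edgeSetDescription F ↔ s(a, b) ∈ F := by
  unfold edgeSetDescription
  rw [← Sym2.map_mk, (Sym2.map.injective Fin.val_injective).mem_finset_image]

theorem exists_walk_of_adj_lifts {D : SimpleGraph ℕ} {H : SimpleGraph (Fin n)}
    (h : ∀ (a : Fin n) (y : ℕ), D.Adj a y → ∃ b : Fin n, (b : ℕ) = y ∧ H.Adj a b) {x y : ℕ}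
    (q : D.Walk x y) : ∀ a : Fin n, (a : ℕ) = x →
      ∃ b : Fin n, (b : ℕ) = y ∧ ∃ r : H.Walk a b, r.length = q.length := by
  induction q with
  | nil => exact fun a ha => ⟨a, ha, Walk.nil, rfl⟩
  | cons hadj q ih =>
    rintro a rfl
    obtain ⟨c, hc, hac⟩ := h a _ hadj
    obtain ⟨b, hb, r, hr⟩ := ih c hc
    exact ⟨b, hb, Walk.cons hac r, by simp [hr]⟩

theorem edist_labelGraph_deleteEdges (F : Finset (Sym2 (Fin n))) (hF : F.card ≤ f + 1) :
    ((labelGraph (natLabel f G s) (natLabel f G t)).deleteEdges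
      (edgeSetDescription F : Set (Sym2 ℕ))).edist s t =
      (G.deleteEdges (F : Set (Sym2 (Fin n)))).edist s t := by
  set D := (labelGraph (natLabel f G s) (natLabel f G t)).deleteEdges
    (edgeSetDescription F : Set (Sym2 ℕ)) with hD
  apply le_antisymm
  · refine le_iInf fun q => ?_
    have hq : Avoids F (q.mapLe (G.deleteEdges_le (F : Set (Sym2 (Fin n))))) := by
      intro e he
      rw [Walk.edges_mapLe_eq_edges] at he
      have := q.edges_subset_edgeSet he
      rw [SimpleGraph.edgeSet_deleteEdges] at this
      exact fun h => this.2 h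
    obtain ⟨r, hr, hlen, hedges⟩ := exists_walk_preserverArcs hF _ hq
    have htransfer : ∀ e ∈ r.edges, e ∈ (D.comap (Fin.val : Fin n → ℕ)).edgeSet := by
      intro e he
      obtain ⟨z, hz, rfl⟩ := hedges e he
      rw [SimpleGraph.mem_edgeSet, SimpleGraph.comap_adj, hD, SimpleGraph.deleteEdges_adj,
        Finset.mem_coe, mk_val_mem_edgeSetDescription]
      exact ⟨labelGraph_adj.2 ⟨z, hz, rfl⟩, hr _ he⟩
    have hle := ((r.transfer _ htransfer).map (SimpleGraph.Hom.comap Fin.val D)).edist_le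
    rw [Walk.length_map, Walk.length_transfer] at hle
    refine hle.trans ?_
    rw [Walk.length_mapLe] at hlen
    exact_mod_cast hlen
  · have hlift : ∀ (a : Fin n) (y : ℕ), D.Adj a y →
        ∃ b : Fin n, (b : ℕ) = y ∧ (G.deleteEdges (F : Set (Sym2 (Fin n)))).Adj a b := by
      intro a y hadj
      rw [hD, SimpleGraph.deleteEdges_adj, labelGraph_adj] at hadj
      obtain ⟨⟨z, hz, heq⟩, hnot⟩ := hadj
      rw [← heq, Finset.mem_coe, mk_val_mem_edgeSetDescription] at hnot
      have hz' : (G.deleteEdges (F : Set (Sym2 (Fin n)))).Adj z.1 z.2 :=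
        SimpleGraph.deleteEdges_adj.2
          ⟨hz.elim adj_of_mem_preserverArcs adj_of_mem_preserverArcs, hnot⟩
      rcases Sym2.eq_iff.1 heq with ⟨h1, h2⟩ | ⟨h1, h2⟩
      · obtain rfl := Fin.ext h1
        exact ⟨z.2, h2, hz'⟩
      · obtain rfl := Fin.ext h2
        exact ⟨z.1, h1, hz'.symm⟩
    refine le_iInf fun q => ?_
    obtain ⟨b, hb, r, hr⟩ := exists_walk_of_adj_lifts hlift q s rfl
    obtain rfl := Fin.ext hb
    rw [← hr]
    exact r.edist_le

theorem length_encodeNats_natLabel_le (G : SimpleGraph (Fin n)) (s : Fin n) :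
    ((encodeNats (natLabel f G s)).length : ℝ) ≤
      13 * ((f + 1) * (f + 1)! * (2 * f + 1 + 2 ^ 2 ^ f) + 1) *
        (n : ℝ) ^ ((2 : ℝ) - 1 / (2 : ℝ) ^ f) * Real.log ((n : ℝ) + 2) ^ 2 := by
  have hn : 1 ≤ n := Nat.one_le_iff_ne_zero.2 fun h => by subst h; exact s.elim0
  have hn' : (1 : ℝ) ≤ n := by exact_mod_cast hn
  have hlt : ∀ x ∈ natLabel f G s, x < 2 ^ (2 * n.size) := by
    have hsize : n * n < 2 ^ (2 * n.size) := by
      rw [two_mul, pow_add]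
      exact Nat.mul_lt_mul'' (Nat.lt_size_self n) (Nat.lt_size_self n)
    intro x hx
    rw [natLabel, List.mem_cons, List.mem_map] at hx
    rcases hx with rfl | ⟨z, -, rfl⟩
    · exact (s.2.trans_le (Nat.le_mul_self n)).trans hsize
    · refine (Nat.pair_lt_max_add_one_sq _ _).trans_le (le_trans ?_ hsize.le)
      rw [sq]
      have : max (z.1 : ℕ) z.2 + 1 ≤ n := max_lt z.1.2 z.2.2
      exact Nat.mul_le_mul this this
  have hlen := length_encodeNats_le hlt
  have hcount : (natLabel f G s).length = (preserverArcs G f s).card + 1 := by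
    simp [natLabel]
  rw [hcount] at hlen
  have hlen' : ((encodeNats (natLabel f G s)).length : ℝ) ≤
      ((preserverArcs G f s).card + 1) * (2 * (2 * n.size) + 1) := by exact_mod_cast hlen
  have hcard := card_preserverArcs_le (G := G) f s
  rw [Fintype.card_fin] at hcard
  have hsize := natSize_le_log hn
  have hL1 : 1 ≤ Real.log ((n : ℝ) + 2) := by
    rw [Real.le_log_iff_exp_le (by linarith)]
    linarith [Real.exp_one_lt_d9]
  have hpow : 1 ≤ (n : ℝ) ^ ((2 : ℝ) - 1 / (2 : ℝ) ^ f) := by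
    refine Real.one_le_rpow hn' ?_
    have : 1 / (2 : ℝ) ^ f ≤ 1 := by
      rw [div_le_one (by positivity)]
      exact one_le_pow₀ (by norm_num)
    linarith
  set L := Real.log ((n : ℝ) + 2)
  set b := (n : ℝ) ^ ((2 : ℝ) - 1 / (2 : ℝ) ^ f)
  set K : ℝ := (f + 1) * (f + 1)! * (2 * f + 1 + 2 ^ 2 ^ f)
  have hbL : 1 ≤ b * L := one_le_mul_of_one_le_of_one_le hpow hL1
  calc _ ≤ (((preserverArcs G f s).card : ℝ) + 1) * (2 * (2 * n.size) + 1) := hlen'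
    _ ≤ (K * b * L + b * L) * (13 * L) := by
        gcongr
        linarith
    _ = _ := by ring

end Scheme

theorem mainTheorem3 (f : ℕ) :
    ∃ S : FTDistanceLabelingScheme (f + 1),
      S.HasLabelSizeSoftO (fun n => (n : ℝ) ^ ((2 : ℝ) - 1 / (2 : ℝ) ^ f)) := by
  let D : List Bool → List ℕ := Function.invFun encodeNats
  have hD : ∀ l, D (encodeNats l) = l := Function.leftInverse_invFun encodeNats_injective
  -- The head of a decoded label is the name of its vertex; the default `0` is never used on labels.
  refine ⟨{ label := fun G s => encodeNats (natLabel f G s)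
            decode := fun l l' F => ((labelGraph (D l) (D l')).deleteEdges
              (F : Set (Sym2 ℕ))).edist ((D l).headD 0) ((D l').headD 0)
            decode_eq := fun G s t F _ hF => ?_ },
    13 * ((f + 1) * (f + 1)! * (2 * f + 1 + 2 ^ 2 ^ f) + 1), 2,
    fun n G v => length_encodeNats_natLabel_le G v⟩
  rw [hD, hD]
  exact edist_labelGraph_deleteEdges F hF
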